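/- Let $n \ge 1$ and $k \ge 0$ be integers. For a partition $\lambda$, let $s_\lambda(x_1,\dots,x_n)=\sum_T x^{\mathrm{wt}(T)}$ be the Schur polynomial, the sum being over all semistandard Young tableaux $T$ of shape $\lambda$ with entries in $\{1,\dots,n\}$, where $x^{\mathrm{wt}(T)}=\prod_{i=1}^n x_i^{\mathrm{wt}_i(T)}$ and $\mathrm{wt}_i(T)$ is the number of entries of $T$ equal to $i$. Put \[ \overline{s}_\lambda(x_1,\dots,x_n) := s_\lambda\bigl((x_1+\dots+x_n)-x_1,\ \dots,\ (x_1+\dots+x_n)-x_n\bigr). \] Let $f^\lambda$ denote the number of standard Young tableaux of shape $\lambda$ (fillings with $1,\dots,|\lambda|$, each used once, increasing along rows and columns; $f^\varnothing=1$), let $\ell(\mu)$ be the number of nonzero parts of $\mu$, and let $\mu+(1^{n-1})$ be the partition obtained from $\mu$ by adding $1$ to each of its first $n-1$ parts ($\mu$ being padded with zeros), i.e. by adding a column of length $n-1$. Then, in the polynomial ring $R[x_1,\dots,x_n]$ over any commutative ring $R$, \[ \overline{s}_{(k)}(x_1,\dots,x_n)=\sum_{\substack{|\mu|=k\\ \ell(\mu)<n}}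 f^{\mu+(1^{n-1})}\, s_\mu(x_1,\dots,x_n), \] where $\mu$ runs over the partitions of $k$ with fewer than $n$ nonzero parts. -/

import Mathlib

namespace ChernPlethysm

/-- The one-row partition `(k)`. -/
def rowShape (k : ℕ) : YoungDiagram where
  cells := {0} ×ˢ Finset.range k
  isLowerSet := by
    rintro ⟨a, b⟩ ⟨c, d⟩ ⟨h1, h2⟩ h
    simp at h h1 h2 ⊢
    omega

/-- The one-column partition `(1^m)`; it is empty for `m = 0`. -/
def colShape (m : ℕ) : YoungDiagram where
  cells := Finset.range m ×ˢ {0}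
  isLowerSet := by
    rintro ⟨a, b⟩ ⟨c, d⟩ ⟨h1, h2⟩ h
    simp at h h1 h2 ⊢
    omega

/-- The componentwise sum of two partitions: row `i` of `add μ ν` has length
`μ.rowLen i + ν.rowLen i`. -/
def add (μ ν : YoungDiagram) : YoungDiagram where
  cells := (Finset.range (μ.colLen 0 + ν.colLen 0) ×ˢ
    Finset.range (μ.rowLen 0 + ν.rowLen 0)).filter
      (fun c => c.2 < μ.rowLen c.1 + ν.rowLen c.1)
  isLowerSet := by
    rintro ⟨a, b⟩ ⟨c, d⟩ ⟨h1, h2⟩ h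
    simp at h h1 h2 ⊢
    have := μ.rowLen_anti c a h1
    have := ν.rowLen_anti c a h1
    omega

theorem mem_add {μ ν : YoungDiagram} {i j : ℕ} :
    (i, j) ∈ add μ ν ↔ j < μ.rowLen i + ν.rowLen i := by
  have h1 := μ.rowLen_anti 0 i (Nat.zero_le i)
  have h2 := ν.rowLen_anti 0 i (Nat.zero_le i)
  have h3 : 0 < μ.rowLen i ↔ i < μ.colLen 0 :=
    YoungDiagram.mem_iff_lt_rowLen.symm.trans YoungDiagram.mem_iff_lt_colLen
  have h4 : 0 < ν.rowLen i ↔ i < ν.colLen 0 :=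
    YoungDiagram.mem_iff_lt_rowLen.symm.trans YoungDiagram.mem_iff_lt_colLen
  rw [← YoungDiagram.mem_cells]
  simp only [add, Finset.mem_filter, Finset.mem_product, Finset.mem_range]
  omega

theorem rowLen_add (μ ν : YoungDiagram) (i : ℕ) :
    (add μ ν).rowLen i = μ.rowLen i + ν.rowLen i := by
  have h : ∀ j, j < (add μ ν).rowLen i ↔ j < μ.rowLen i + ν.rowLen i := fun j =>
    YoungDiagram.mem_iff_lt_rowLen.symm.trans mem_add
  have h1 := h ((add μ ν).rowLen i)
  have h2 := h (μ.rowLen i + ν.rowLen i)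
  omega

theorem finite_card_eq (k : ℕ) : {μ : YoungDiagram | μ.card = k}.Finite := by
  refine Set.Finite.of_finite_image (f := YoungDiagram.cells)
    (Set.Finite.subset (Finset.finite_toSet
      (Finset.range k ×ˢ Finset.range k).powerset) ?_)
    (fun μ _ ν _ h => YoungDiagram.ext h)
  rintro _ ⟨μ, rfl, rfl⟩
  simp only [Finset.mem_coe, Finset.mem_powerset]
  rintro ⟨i, j⟩ hc
  have hi : i < μ.colLen 0 :=
    YoungDiagram.mem_iff_lt_colLen.1 (μ.up_left_mem le_rfl (Nat.zero_le j) hc)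
  have hj : j < μ.rowLen 0 :=
    YoungDiagram.mem_iff_lt_rowLen.1 (μ.up_left_mem (Nat.zero_le i) le_rfl hc)
  rw [YoungDiagram.colLen_eq_card] at hi
  rw [YoungDiagram.rowLen_eq_card] at hj
  have h1 : (μ.col 0).card ≤ μ.card := Finset.card_le_card (Finset.filter_subset _ _)
  have h2 : (μ.row 0).card ≤ μ.card := Finset.card_le_card (Finset.filter_subset _ _)
  simp only [Finset.mem_product, Finset.mem_range]
  omega

/-- The finite set of all partitions `μ` with `|μ| = k`. -/
noncomputable def partitionsOf (k : ℕ) : Finset YoungDiagram :=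
  (finite_card_eq k).toFinset

theorem mem_partitionsOf {k : ℕ} {μ : YoungDiagram} : μ ∈ partitionsOf k ↔ μ.card = k := by
  simp [partitionsOf]

theorem finite_ssyt (μ : YoungDiagram) (n : ℕ) :
    {T : SemistandardYoungTableau μ | ∀ i j, (i, j) ∈ μ → T i j < n}.Finite := by
  rw [← Set.finite_coe_iff]
  refine Finite.of_injective
    (β := μ.cells → Fin n)
    (fun T c => ⟨T.1 c.1.1 c.1.2, T.2 _ _ c.2⟩) ?_
  intro T T' h
  refine Subtype.ext (SemistandardYoungTableau.ext fun i j => ?_)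
  by_cases hc : (i, j) ∈ μ
  · simpa using congrFun h ⟨(i, j), hc⟩
  · rw [T.1.zeros hc, T'.1.zeros hc]

/-- `SSYT(μ, n)`: the semistandard Young tableaux of shape `μ` with entries in an alphabet of
`n` letters. The alphabet is `{0, …, n - 1}` instead of `{1, …, n}`. -/
noncomputable def ssyt (μ : YoungDiagram) (n : ℕ) : Finset (SemistandardYoungTableau μ) :=
  (finite_ssyt μ n).toFinset

theorem mem_ssyt {μ : YoungDiagram} {n : ℕ} {T : SemistandardYoungTableau μ} :
    T ∈ ssyt μ n ↔ ∀ i j, (i, j) ∈ μ → T i j < n := by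
  simp [ssyt]

/-- The tableau `T` uses each value at most once and is strictly increasing along rows. -/
def IsStandard {μ : YoungDiagram} (T : SemistandardYoungTableau μ) : Prop :=
  (∀ i j i' j', (i, j) ∈ μ → (i', j') ∈ μ → T i j = T i' j' → i = i' ∧ j = j') ∧
  (∀ i j j', j < j' → (i, j') ∈ μ → T i j < T i j')

open Classical in
/-- `f^μ`: the number of standard Young tableaux of shape `μ`, with entries in an alphabet of
`|μ|` letters (so that each letter is used exactly once). -/
noncomputable def numSYT (μ : YoungDiagram) : ℕ :=
  ((ssyt μ μ.card).filter (fun T => IsStandard T)).card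

/-- `wt_i(T)`: the number of cells of `T` with entry `i`. -/
def wt {μ : YoungDiagram} (T : SemistandardYoungTableau μ) (i : ℕ) : ℕ :=
  (μ.cells.filter (fun c => T c.1 c.2 = i)).card

/-- The Schur polynomial `s_μ(x_1, …, x_n)`, the generating function of `SSYT(μ, n)`. -/
noncomputable def schur (R : Type*) [CommRing R] (n : ℕ) (μ : YoungDiagram) :
    MvPolynomial (Fin n) R :=
  ∑ T ∈ ssyt μ n, ∏ i : Fin n, MvPolynomial.X i ^ wt T i

/-- The Chern plethysm with inner partition `(1^{n-1})`: the Schur polynomial `s_μ` evaluated at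
the `n` elements `(x_1 + ⋯ + x_n) - x_i`. -/
noncomputable def schurBar (R : Type*) [CommRing R] (n : ℕ) (μ : YoungDiagram) :
    MvPolynomial (Fin n) R :=
  MvPolynomial.aeval
    (fun i : Fin n => (∑ j : Fin n, (MvPolynomial.X j : MvPolynomial (Fin n) R)) -
      MvPolynomial.X i)
    (schur R n μ)

end ChernPlethysm

namespace ChernPlethysm

open Finset Matrix

/-! Everything is multiplied by the Vandermonde determinant `V(x)` and compared as alternants. The
bialternant formula `vandermonde_mul_schurEval` holds for tuples in any commutative ring, so it
applies at `y_i = e₁ - x_i` as well as at the variables. Its proof is an induction on the number of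
variables, matching the branching rule `sum_ssyt_succ` with the expansion `alternant_succ`.

Put `n = m + 1`. At `y` the one-row alternant expands along its last column, and `V(y)` is `V(x)` up
to sign. Since `y_i` is the sum of the `x_j` with `j ≠ i`, this gives `V(x) s_(k)(y) = ∑ (-1)^i
y_i^(k+m) V(x without x_i)`. Iterating the Pieri rule (`sum_pow_mul_vandermonde`) writes each
`y_i^(k+m) V(x without x_i)` as a sum of `f^ξ` times alternants in `m` variables, with `|ξ| = k +
m`. The alternating sum over `i` is a Laplace expansion that prepends the exponent `0`
(`sum_alternant_succAbove`). The result vanishes unless `ξ` has exactly `m` rows, i.e. `ξ = μ +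
(1^m)`, and then it is the alternant of `μ` in `m + 1` variables. Cancelling `V(x)` over `ℤ` and
changing base finishes the proof. -/

variable {A : Type*} [CommRing A]

/-! ### Alternants -/

/-- The generalised Vandermonde determinant `det (x_i ^ β_j)`. -/
def alternant {n : ℕ} (x : Fin n → A) (β : Fin n → ℕ) : A :=
  (Matrix.of fun i j => x i ^ β j).det

theorem alternant_val {n : ℕ} (x : Fin n → A) :
    alternant x (fun j => (j : ℕ)) = (vandermonde x).det := rfl

theorem alternant_eq_zero_of_eq {n : ℕ} (x : Fin n → A) (β : Fin n → ℕ) {i j : Fin n}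
    (hij : i ≠ j) (h : β i = β j) : alternant x β = 0 :=
  Matrix.det_zero_of_column_eq hij fun k => by simp [h]

/-- In the Leibniz term of `σ`, the sum of the variables can be written `∑ j, x (σ j)`, and the
factor `x (σ j)` raises the exponent of column `j` by one. -/
theorem sum_mul_alternant {n : ℕ} (x : Fin n → A) (β : Fin n → ℕ) :
    (∑ i, x i) * alternant x β = ∑ j, alternant x (fun l => β l + if l = j then 1 else 0) := by
  simp only [alternant, Matrix.det_apply, Matrix.of_apply]
  rw [Finset.sum_comm, Finset.mul_sum]
  refine Finset.sum_congr rfl fun σ _ => ?_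
  rw [← Finset.smul_sum, mul_smul_comm, ← Equiv.sum_comp σ x, Finset.sum_mul]
  congr 1
  refine Finset.sum_congr rfl fun j _ => ?_
  simp only [pow_add, Finset.prod_mul_distrib]
  rw [mul_comm]
  congr 1
  simp [pow_ite]

theorem alternant_sum {n : ℕ} (x : Fin n → A) (s : Fin n → Finset ℕ) (c : Fin n → ℕ → A) :
    (Matrix.of fun i j => ∑ b ∈ s j, c j b * x i ^ b).det =
      ∑ b ∈ Fintype.piFinset s, (∏ j, c j (b j)) * alternant x b := by
  rw [← Matrix.det_transpose]
  have h := (Matrix.detRowAlternating (R := A) (n := Fin n)).toMultilinearMap.map_sum_finset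
    (fun j b => c j b • fun i => x i ^ b) s
  refine Eq.trans ?_ (h.trans ?_)
  · change Matrix.det _ = Matrix.det _
    congr 1
    ext j i
    simp
  · refine Finset.sum_congr rfl fun b _ => ?_
    rw [MultilinearMap.map_smul_univ, smul_eq_mul]
    congr 1
    change Matrix.det _ = Matrix.det _
    rw [← Matrix.det_transpose]
    rfl

/-- Expansion of an alternant along the powers of its last variable. -/
theorem alternant_succ {n : ℕ} (x : Fin (n + 1) → A) (β : Fin (n + 1) → ℕ)
    (hβ : ∀ j : Fin n, β j.castSucc ≤ β j.succ) :
    alternant x β = (∏ i : Fin n, (x (Fin.last n) - x i.castSucc)) *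
      ∑ b ∈ Fintype.piFinset fun j : Fin n => Ico (β j.castSucc) (β j.succ),
        (x (Fin.last n) ^ β 0 * ∏ j, x (Fin.last n) ^ (β j.succ - 1 - b j)) *
          alternant (fun i : Fin n => x i.castSucc) b := by
  set z := x (Fin.last n) with hz
  -- Subtracting from each column a power of `z` times its predecessor clears the last row except
  -- for its first entry. The remaining entries are then divisible by `x i - z`, with geometric sums
  -- as quotients.
  set B : Matrix (Fin (n + 1)) (Fin (n + 1)) A := Matrix.of fun i => Fin.cons (x i ^ β 0)
    fun j => x i ^ β j.succ - z ^ (β j.succ - β j.castSucc) * x i ^ β j.castSucc with hB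
  have h1 : alternant x β = B.det := by
    refine Matrix.det_eq_of_forall_col_eq_smul_add_pred
      (fun j : Fin n => z ^ (β j.succ - β j.castSucc)) (fun i => by simp [hB])
      (fun i j => by simp [hB])
  have hlast : ∀ j : Fin n, B (Fin.last n) j.succ = 0 := fun j => by
    simp [hB, ← hz, ← pow_add, Nat.sub_add_cancel (hβ j)]
  have h2 : B.submatrix Fin.castSucc Fin.succ = Matrix.of fun i j : Fin n =>
      (x i.castSucc - z) * ((Matrix.of fun i j : Fin n =>
        ∑ b ∈ Ico (β j.castSucc) (β j.succ), z ^ (β j.succ - 1 - b) * x i.castSucc ^ b) i j) := by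
    ext i j
    simp only [hB, Matrix.submatrix_apply, Matrix.of_apply, Fin.cons_succ]
    rw [mul_comm (z ^ _), ← (Commute.all (x i.castSucc) z).mul_geom_sum₂_Ico (hβ j)]
    simp [mul_comm]
  rw [h1, Matrix.det_succ_row B (Fin.last n), Fin.sum_univ_succ]
  simp only [hlast, mul_zero, zero_mul, Finset.sum_const_zero, add_zero, Fin.succAbove_last,
    Fin.succAbove_zero]
  rw [h2, Matrix.det_mul_column, alternant_sum (fun i : Fin n => x i.castSucc)]
  have h3 : ∏ i : Fin n, (x i.castSucc - z) = (-1) ^ n * ∏ i : Fin n, (z - x i.castSucc) := by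
    have h := Finset.prod_neg (s := univ) (fun i : Fin n => z - x i.castSucc)
    simpa using h
  rw [h3]
  simp only [mul_assoc, ← Finset.mul_sum]
  simp only [Fin.val_last, Fin.val_zero, add_zero, hB, Matrix.of_apply, Fin.cons_zero, ← hz]
  have h4 : ((-1 : A) ^ n) * (-1) ^ n = 1 := by rw [← mul_pow]; simp
  linear_combination (z ^ β 0 * ((∏ i : Fin n, (z - x i.castSucc)) *
    ∑ b ∈ Fintype.piFinset fun j : Fin n => Ico (β j.castSucc) (β j.succ),
      (∏ j, z ^ (β j.succ - 1 - b j)) * alternant (fun i : Fin n => x i.castSucc) b)) * h4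

/-- This is `alternant_succ` for `β = (0, 1, …, n)`: each interval of exponents contains a single
point. -/
theorem vandermonde_det_succ {n : ℕ} (x : Fin (n + 1) → A) :
    (vandermonde x).det = (∏ i : Fin n, (x (Fin.last n) - x i.castSucc)) *
      (vandermonde fun i : Fin n => x i.castSucc).det := by
  rw [← alternant_val, alternant_succ x _ (fun j => by simp)]
  congr 1
  rw [Finset.sum_eq_single_of_mem (fun j : Fin n => (j : ℕ)) (by simp)]
  · simp [alternant_val]
  · intro b hb hne
    refine absurd (funext fun j => ?_) hne
    have := Fintype.mem_piFinset.1 hb j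
    simp at this
    omega

/-! ### Diagrams from row lengths, and horizontal strips -/

theorem eq_of_rowLen_eq {μ ν : YoungDiagram} (h : ∀ i, μ.rowLen i = ν.rowLen i) : μ = ν := by
  refine SetLike.ext fun ⟨i, j⟩ => ?_
  rw [YoungDiagram.mem_iff_lt_rowLen, YoungDiagram.mem_iff_lt_rowLen, h]

/-- The Young diagram with prescribed row lengths. -/
def ofRowFun (f : ℕ → ℕ) (hf : Antitone f) (m : ℕ) : YoungDiagram where
  cells := (range m ×ˢ range (f 0)).filter fun c => c.2 < f c.1
  isLowerSet := by
    rintro ⟨a, b⟩ ⟨c, d⟩ ⟨h1, h2⟩ h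
    simp at h h1 h2 ⊢
    have := hf h1
    have := hf (Nat.zero_le c)
    omega

theorem rowLen_ofRowFun (f : ℕ → ℕ) (hf : Antitone f) (m : ℕ) (hm : f m = 0) (i : ℕ) :
    (ofRowFun f hf m).rowLen i = f i := by
  have h : ∀ j, j < (ofRowFun f hf m).rowLen i ↔ j < f i := fun j => by
    rw [← YoungDiagram.mem_iff_lt_rowLen, ← YoungDiagram.mem_cells]
    simp only [ofRowFun, mem_filter, mem_product, mem_range]
    have := hf (Nat.zero_le i)
    refine ⟨fun h => h.2, fun h => ⟨⟨?_, by omega⟩, h⟩⟩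
    by_contra hi
    have := hf (not_lt.1 hi)
    omega
  have h1 := h (f i)
  have h2 := h ((ofRowFun f hf m).rowLen i)
  omega

theorem card_eq_sum_rowLen {μ : YoungDiagram} {m : ℕ} (hm : μ.rowLen m = 0) :
    μ.card = ∑ i ∈ range m, μ.rowLen i := by
  have h : ∀ c ∈ μ.cells, c.1 ∈ range m := by
    rintro ⟨i, j⟩ hc
    rw [YoungDiagram.mem_cells, YoungDiagram.mem_iff_lt_rowLen] at hc
    rw [mem_range]
    by_contra hi
    have := μ.rowLen_anti m i (not_lt.1 hi)
    omega
  rw [YoungDiagram.card, Finset.card_eq_sum_card_fiberwise h]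
  exact Finset.sum_congr rfl fun i _ => (YoungDiagram.rowLen_eq_card μ).symm

theorem colLen_zero_le_iff {μ : YoungDiagram} {m : ℕ} : μ.colLen 0 ≤ m ↔ μ.rowLen m = 0 := by
  have : 0 < μ.rowLen m ↔ m < μ.colLen 0 :=
    YoungDiagram.mem_iff_lt_rowLen.symm.trans YoungDiagram.mem_iff_lt_colLen
  omega

/-- The rows of `ν` and `μ` interlace, i.e. `ν ⊆ μ` and `μ / ν` is a horizontal strip. -/
def Interlace (ν μ : YoungDiagram) : Prop :=
  ∀ i, ν.rowLen i ≤ μ.rowLen i ∧ μ.rowLen (i + 1) ≤ ν.rowLen i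

theorem Interlace.le {ν μ : YoungDiagram} (h : Interlace ν μ) : ν ≤ μ := by
  rintro ⟨i, j⟩ hc
  change (i, j) ∈ ν at hc
  rw [YoungDiagram.mem_iff_lt_rowLen] at *
  exact hc.trans_le (h i).1

theorem finite_interlace (μ : YoungDiagram) : {ν | Interlace ν μ}.Finite := by
  refine Set.Finite.of_finite_image (f := YoungDiagram.cells)
    (Set.Finite.subset (Finset.finite_toSet μ.cells.powerset) ?_)
    (fun μ _ ν _ h => YoungDiagram.ext h)
  rintro _ ⟨ν, h, rfl⟩
  simpa using Interlace.le h

/-- The finite set of diagrams obtained from `μ` by removing a horizontal strip. -/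
noncomputable def strips (μ : YoungDiagram) : Finset YoungDiagram := (finite_interlace μ).toFinset

theorem mem_strips {μ ν : YoungDiagram} : ν ∈ strips μ ↔ Interlace ν μ := by simp [strips]

/-! ### Branching of tableaux by the largest letter -/

/-- The cells of `T` with entry less than `n`. -/
def below {μ : YoungDiagram} (T : SemistandardYoungTableau μ) (n : ℕ) : YoungDiagram where
  cells := μ.cells.filter fun c => T c.1 c.2 < n
  isLowerSet := by
    rintro ⟨a, b⟩ ⟨c, d⟩ ⟨h1, h2⟩ h
    simp at h h1 h2 ⊢
    have h3 : (a, d) ∈ μ := μ.up_left_mem le_rfl h2 h.1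
    exact ⟨μ.up_left_mem h1 h2 h.1,
      ((T.col_weak h1 h3).trans (T.row_weak_of_le h2 h.1)).trans_lt h.2⟩

theorem mem_below {μ : YoungDiagram} {T : SemistandardYoungTableau μ} {n i j : ℕ} :
    (i, j) ∈ below T n ↔ (i, j) ∈ μ ∧ T i j < n := by
  rw [← YoungDiagram.mem_cells, below, Finset.mem_filter, YoungDiagram.mem_cells]

/-- The subtableau of entries less than `n`. -/
def restrict {μ : YoungDiagram} (T : SemistandardYoungTableau μ) {n : ℕ} {ν : YoungDiagram}
    (h : below T n = ν) : SemistandardYoungTableau ν where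
  entry i j := if (i, j) ∈ ν then T i j else 0
  row_weak' {i j1 j2} hj hc := by
    rw [if_pos hc, if_pos (ν.up_left_mem le_rfl hj.le hc)]
    subst h
    exact T.row_weak hj (mem_below.1 hc).1
  col_strict' {i1 i2 j} hi hc := by
    rw [if_pos hc, if_pos (ν.up_left_mem hi.le le_rfl hc)]
    subst h
    exact T.col_strict hi (mem_below.1 hc).1
  zeros' h := if_neg h

theorem restrict_apply {μ : YoungDiagram} (T : SemistandardYoungTableau μ) {n : ℕ}
    {ν : YoungDiagram} (h : below T n = ν) (i j : ℕ) :
    restrict T h i j = if (i, j) ∈ ν then T i j else 0 := rfl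

/-- Fill the cells of a horizontal strip `μ / ν` with the letter `n`. -/
def extend {ν μ : YoungDiagram} (S : SemistandardYoungTableau ν) {n : ℕ} (hS : S ∈ ssyt ν n)
    (h : Interlace ν μ) : SemistandardYoungTableau μ where
  entry i j := if (i, j) ∈ ν then S i j else if (i, j) ∈ μ then n else 0
  row_weak' {i j1 j2} hj hc := by
    have h1 : (i, j1) ∈ μ := μ.up_left_mem le_rfl hj.le hc
    by_cases h2 : (i, j2) ∈ ν
    · rw [if_pos h2, if_pos (ν.up_left_mem le_rfl hj.le h2)]
      exact S.row_weak hj h2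
    · rw [if_neg h2, if_pos hc]
      split_ifs with h3
      · exact (mem_ssyt.1 hS _ _ h3).le
      · rfl
  col_strict' {i1 i2 j} hi hc := by
    -- Since `i1 + 1 ≤ i2`, interlacing puts every cell of `μ` above row `i2` in the same column
    -- inside `ν`: the strip has at most one cell per column.
    have h1 : (i1, j) ∈ ν := by
      rw [YoungDiagram.mem_iff_lt_rowLen] at *
      exact (hc.trans_le (μ.rowLen_anti _ _ hi)).trans_le (h i1).2
    by_cases h2 : (i2, j) ∈ ν
    · rw [if_pos h2, if_pos h1]
      exact S.col_strict hi h2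
    · rw [if_neg h2, if_pos hc, if_pos h1]
      exact mem_ssyt.1 hS _ _ h1
  zeros' {i j} hc := by
    rw [if_neg fun hν => hc (h.le hν), if_neg hc]

theorem extend_apply {ν μ : YoungDiagram} (S : SemistandardYoungTableau ν) {n : ℕ}
    (hS : S ∈ ssyt ν n) (h : Interlace ν μ) (i j : ℕ) :
    extend S hS h i j = if (i, j) ∈ ν then S i j else if (i, j) ∈ μ then n else 0 := rfl

theorem below_extend {ν μ : YoungDiagram} (S : SemistandardYoungTableau ν) {n : ℕ}
    (hS : S ∈ ssyt ν n) (h : Interlace ν μ) : below (extend S hS h) n = ν := by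
  refine SetLike.ext fun ⟨i, j⟩ => ?_
  rw [mem_below, extend_apply]
  constructor
  · rintro ⟨h1, h2⟩
    by_contra h3
    rw [if_neg h3, if_pos h1] at h2
    exact lt_irrefl _ h2
  · intro h1
    rw [if_pos h1]
    exact ⟨h.le h1, mem_ssyt.1 hS _ _ h1⟩

theorem interlace_below {μ : YoungDiagram} {T : SemistandardYoungTableau μ} {n : ℕ}
    (hT : T ∈ ssyt μ (n + 1)) : Interlace (below T n) μ := by
  intro i
  constructor
  · by_contra h
    have h1 := YoungDiagram.mem_iff_lt_rowLen.2 (not_le.1 h)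
    exact lt_irrefl _ (YoungDiagram.mem_iff_lt_rowLen.1 (mem_below.1 h1).1)
  · by_contra h
    have h1 := YoungDiagram.mem_iff_lt_rowLen.2 (not_le.1 h)
    have h2 := T.col_strict (Nat.lt_add_one i) h1
    have h3 := mem_ssyt.1 hT _ _ h1
    have h4 : (i, (below T n).rowLen i) ∈ below T n :=
      mem_below.2 ⟨μ.up_left_mem (Nat.le_succ i) le_rfl h1, by omega⟩
    exact lt_irrefl _ (YoungDiagram.mem_iff_lt_rowLen.1 h4)

theorem wt_extend {ν μ : YoungDiagram} (S : SemistandardYoungTableau ν) {n : ℕ}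
    (hS : S ∈ ssyt ν n) (h : Interlace ν μ) :
    wt (extend S hS h) = fun i => if i = n then μ.card - ν.card else wt S i := by
  funext k
  split_ifs with hk
  · subst hk
    rw [wt, YoungDiagram.card, YoungDiagram.card, ← Finset.card_sdiff_of_subset h.le]
    congr 1
    ext ⟨i, j⟩
    rw [mem_filter, mem_sdiff]
    simp only [YoungDiagram.mem_cells, extend_apply]
    refine and_congr_right fun h1 => ?_
    split_ifs with h2
    · simpa [h2] using (mem_ssyt.1 hS _ _ h2).ne
    · simp [h2]
  · rw [wt, wt]
    congr 1
    ext ⟨i, j⟩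
    rw [mem_filter, mem_filter]
    simp only [YoungDiagram.mem_cells, extend_apply]
    split_ifs with h1 h2
    · simp [h1, h.le h1]
    · simp [h1, Ne.symm hk]
    · simp [h1, h2]

theorem extend_mem_ssyt {ν μ : YoungDiagram} (S : SemistandardYoungTableau ν) {n : ℕ}
    (hS : S ∈ ssyt ν n) (h : Interlace ν μ) : extend S hS h ∈ ssyt μ (n + 1) := by
  rw [mem_ssyt]
  intro i j hc
  rw [extend_apply]
  split_ifs with h1
  · exact (mem_ssyt.1 hS _ _ h1).trans (Nat.lt_succ_self n)
  · exact Nat.lt_succ_self n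

theorem restrict_mem_ssyt {μ : YoungDiagram} (T : SemistandardYoungTableau μ) {n : ℕ}
    {ν : YoungDiagram} (h : below T n = ν) : restrict T h ∈ ssyt ν n := by
  rw [mem_ssyt]
  intro i j hc
  rw [restrict_apply, if_pos hc]
  subst h
  exact (mem_below.1 hc).2

theorem extend_restrict {μ : YoungDiagram} (T : SemistandardYoungTableau μ) {n : ℕ}
    (hT : T ∈ ssyt μ (n + 1)) {ν : YoungDiagram} (h : below T n = ν) (hν : Interlace ν μ) :
    extend (restrict T h) (restrict_mem_ssyt T h) hν = T := by
  ext i j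
  rw [extend_apply, restrict_apply]
  split_ifs with h1 h2
  · rfl
  · have h3 := mem_ssyt.1 hT _ _ h2
    rw [← h, mem_below] at h1
    have : ¬ T i j < n := fun h4 => h1 ⟨h2, h4⟩
    omega
  · exact (T.zeros h2).symm

/-- Branching rule: summing over tableaux by removing the cells of the largest letter. -/
theorem sum_ssyt_succ {M : Type*} [AddCommMonoid M] (μ : YoungDiagram) (n : ℕ)
    (G : (ℕ → ℕ) → M) :
    ∑ T ∈ ssyt μ (n + 1), G (wt T) = ∑ ν ∈ strips μ, ∑ S ∈ ssyt ν n,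
      G (fun i => if i = n then μ.card - ν.card else wt S i) := by
  classical
  rw [← Finset.sum_fiberwise_of_maps_to (g := fun T => below T n)
    (fun T hT => mem_strips.2 (interlace_below hT))]
  refine Finset.sum_congr rfl fun ν hν => ?_
  have hν' := mem_strips.1 hν
  refine Finset.sum_bij' (fun T hT => restrict T (mem_filter.1 hT).2)
    (fun S hS => extend S hS hν') (fun T hT => restrict_mem_ssyt T _)
    (fun S hS => mem_filter.2 ⟨extend_mem_ssyt S hS hν', below_extend S hS hν'⟩)
    (fun T hT => extend_restrict T (mem_filter.1 hT).1 _ hν') (fun S hS => ?_) (fun T hT => ?_)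
  · ext i j
    rw [restrict_apply, extend_apply]
    split_ifs with h1
    · rfl
    · exact (S.zeros h1).symm
  · rw [← wt_extend (restrict T _) (restrict_mem_ssyt T _) hν',
      extend_restrict T (mem_filter.1 hT).1]

theorem le_entry {μ : YoungDiagram} (T : SemistandardYoungTableau μ) :
    ∀ {i j : ℕ}, (i, j) ∈ μ → i ≤ T i j
  | 0, _, _ => Nat.zero_le _
  | i + 1, _, h => (le_entry T (μ.up_left_mem (Nat.le_succ i) le_rfl h)).trans_lt
      (T.col_strict (Nat.lt_succ_self i) h)

theorem ssyt_eq_empty {μ : YoungDiagram} {n : ℕ} (h : μ.rowLen n ≠ 0) : ssyt μ n = ∅ := by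
  refine Finset.eq_empty_of_forall_notMem fun T hT => ?_
  have h1 : (n, 0) ∈ μ := YoungDiagram.mem_iff_lt_rowLen.2 (Nat.pos_of_ne_zero h)
  exact absurd (mem_ssyt.1 hT _ _ h1) (le_entry T h1).not_gt

theorem eq_bot_of_rowLen {μ : YoungDiagram} (h : μ.rowLen 0 = 0) : μ = ⊥ := by
  refine le_bot_iff.1 ?_
  rintro ⟨i, j⟩ hc
  have := YoungDiagram.mem_iff_lt_rowLen.1 hc
  have := μ.rowLen_anti 0 i (Nat.zero_le i)
  omega

theorem rowLen_bot (i : ℕ) : (⊥ : YoungDiagram).rowLen i = 0 := by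
  by_contra h
  exact YoungDiagram.notMem_bot _ (YoungDiagram.mem_iff_lt_rowLen.2 (Nat.pos_of_ne_zero h))

theorem ssyt_bot (n : ℕ) : ssyt ⊥ n = {default} := by
  refine Finset.eq_singleton_iff_unique_mem.2 ⟨?_, fun T _ => ?_⟩
  · rw [mem_ssyt]
    exact fun i j h => absurd h (YoungDiagram.notMem_bot _)
  · ext i j
    rw [T.zeros (YoungDiagram.notMem_bot _), SemistandardYoungTableau.zeros _
      (YoungDiagram.notMem_bot _)]

/-! ### The bialternant formula -/

/-- The value of the Schur polynomial `s_μ` at a tuple of ring elements. -/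
noncomputable def schurEval {n : ℕ} (x : Fin n → A) (μ : YoungDiagram) : A :=
  ∑ T ∈ ssyt μ n, ∏ i : Fin n, x i ^ wt T i

/-- The exponents `μ + δ` in increasing order. -/
def shiftedParts (n : ℕ) (μ : YoungDiagram) (j : Fin n) : ℕ := μ.rowLen (n - 1 - j) + j

theorem schurEval_eq_zero {n : ℕ} (x : Fin n → A) {μ : YoungDiagram} (h : μ.rowLen n ≠ 0) :
    schurEval x μ = 0 := by
  rw [schurEval, ssyt_eq_empty h, Finset.sum_empty]

theorem schurEval_succ {n : ℕ} (x : Fin (n + 1) → A) (μ : YoungDiagram) :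
    schurEval x μ = ∑ ν ∈ strips μ,
      x (Fin.last n) ^ (μ.card - ν.card) * schurEval (fun i : Fin n => x i.castSucc) ν := by
  rw [schurEval, sum_ssyt_succ μ n (fun w => ∏ i : Fin (n + 1), x i ^ w i)]
  refine Finset.sum_congr rfl fun ν _ => ?_
  rw [schurEval, Finset.mul_sum]
  refine Finset.sum_congr rfl fun S _ => ?_
  rw [Fin.prod_univ_castSucc, mul_comm]
  congr 1
  · simp
  · refine Finset.prod_congr rfl fun i _ => ?_
    simp [i.2.ne]

/-- After removing the shift, the half-open intervals for `b` become exactly the interlacing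
inequalities, read with row `i = n - 1 - j`. They also force the recovered row lengths to decrease.
-/
theorem exists_shiftedParts_eq {n : ℕ} {μ : YoungDiagram} (hμ : μ.rowLen (n + 1) = 0)
    {b : Fin n → ℕ} (hb : ∀ j : Fin n, b j ∈ Ico (shiftedParts (n + 1) μ j.castSucc)
      (shiftedParts (n + 1) μ j.succ)) :
    ∃ ν, Interlace ν μ ∧ ν.rowLen n = 0 ∧ shiftedParts n ν = b := by
  have hb' : ∀ (i : ℕ) (hi : i < n), μ.rowLen (i + 1) + (n - 1 - i) ≤ b ⟨n - 1 - i, by omega⟩ ∧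
      b ⟨n - 1 - i, by omega⟩ ≤ μ.rowLen i + (n - 1 - i) := by
    intro i hi
    have h := hb ⟨n - 1 - i, by omega⟩
    simp only [shiftedParts, mem_Ico, Fin.val_castSucc, Fin.val_succ] at h
    rw [show n + 1 - 1 - (n - 1 - i) = i + 1 by omega,
      show n + 1 - 1 - (n - 1 - i + 1) = i by omega] at h
    omega
  set f : ℕ → ℕ := fun i => if h : i < n then b ⟨n - 1 - i, by omega⟩ - (n - 1 - i) else 0
    with hf
  have hf1 : ∀ i, i < n → f i ≤ μ.rowLen i ∧ μ.rowLen (i + 1) ≤ f i := by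
    intro i hi
    have := hb' i hi
    simp only [hf, dif_pos hi]
    omega
  have hf2 : ∀ i, n ≤ i → f i = 0 := fun i hi => by simp [hf, hi.not_gt]
  have hanti : Antitone f := by
    refine antitone_nat_of_succ_le fun i => ?_
    by_cases hi : i + 1 < n
    · exact (hf1 _ hi).1.trans (hf1 i (by omega)).2
    · rw [hf2 _ (not_lt.1 hi)]
      exact Nat.zero_le _
  refine ⟨ofRowFun f hanti n, fun i => ?_, ?_, ?_⟩
  · rw [rowLen_ofRowFun f hanti n (hf2 n le_rfl)]
    by_cases hi : i < n
    · exact hf1 i hi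
    · rw [hf2 i (not_lt.1 hi)]
      have := μ.rowLen_anti (n + 1) (i + 1) (by omega)
      omega
  · rw [rowLen_ofRowFun f hanti n (hf2 n le_rfl), hf2 n le_rfl]
  · funext j
    have hj := j.2
    rw [shiftedParts, rowLen_ofRowFun f hanti n (hf2 n le_rfl)]
    have h := hb' (n - 1 - j) (by omega)
    simp only [hf, dif_pos (show n - 1 - (j : ℕ) < n by omega)]
    simp only [show n - 1 - (n - 1 - (j : ℕ)) = j by omega, Fin.eta] at h ⊢
    omega

/-- Matches the exponent of the last variable on the two sides of the induction: the term at `0` is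
the last row of `μ`, which lies wholly in the strip, and the others are the row differences. -/
theorem card_sub_card_eq {n : ℕ} {μ ν : YoungDiagram} (hμ : μ.rowLen (n + 1) = 0)
    (hν : ν.rowLen n = 0) (h : Interlace ν μ) :
    shiftedParts (n + 1) μ 0 +
      ∑ j : Fin n, (shiftedParts (n + 1) μ j.succ - 1 - shiftedParts n ν j) =
        μ.card - ν.card := by
  rw [card_eq_sum_rowLen hμ, card_eq_sum_rowLen hν, Finset.sum_range_succ]
  have h1 : ∑ j : Fin n, (shiftedParts (n + 1) μ j.succ - 1 - shiftedParts n ν j) =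
      ∑ i ∈ range n, (μ.rowLen i - ν.rowLen i) := by
    rw [← Finset.sum_range_reflect, Finset.sum_range]
    refine Finset.sum_congr rfl fun j _ => ?_
    have hj := j.2
    simp only [shiftedParts, Fin.val_succ]
    rw [show n + 1 - 1 - ((j : ℕ) + 1) = n - 1 - j by omega]
    omega
  have h2 : ∑ i ∈ range n, (μ.rowLen i - ν.rowLen i) + ∑ i ∈ range n, ν.rowLen i =
      ∑ i ∈ range n, μ.rowLen i := by
    rw [← Finset.sum_add_distrib]
    exact Finset.sum_congr rfl fun i _ => Nat.sub_add_cancel (h i).1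
  rw [h1]
  simp only [shiftedParts, Fin.val_zero]
  simp only [Nat.add_sub_cancel, Nat.sub_zero, add_zero]
  omega

/-- The bialternant formula for Schur polynomials. -/
theorem vandermonde_mul_schurEval {n : ℕ} (x : Fin n → A) {μ : YoungDiagram}
    (hμ : μ.rowLen n = 0) :
    (vandermonde x).det * schurEval x μ = alternant x (shiftedParts n μ) := by
  induction n generalizing μ with
  | zero =>
    obtain rfl := eq_bot_of_rowLen hμ
    simp [schurEval, ssyt_bot, alternant]
  | succ n ih =>
    classical
    rw [schurEval_succ, vandermonde_det_succ, alternant_succ, mul_assoc, Finset.mul_sum]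
    swap
    · intro j
      have hj := j.2
      have := μ.rowLen_anti (n - (j + 1)) (n - j) (by omega)
      simp only [shiftedParts, Fin.val_castSucc, Fin.val_succ, Nat.add_sub_cancel]
      omega
    congr 1
    -- Diagrams with more than `n` rows carry no tableau on `n` letters; on the rest, `shiftedParts
    -- n` is a bijection onto the exponent vectors of `alternant_succ`.
    rw [← Finset.sum_filter_of_ne (p := fun ν : YoungDiagram => ν.rowLen n = 0)]
    swap
    · intro ν _ hne
      by_contra h
      exact hne (by rw [schurEval_eq_zero _ h, mul_zero, mul_zero])
    refine Finset.sum_bij (fun ν _ => shiftedParts n ν) ?_ ?_ ?_ ?_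
    · intro ν hν
      simp only [mem_filter, mem_strips] at hν
      rw [Fintype.mem_piFinset]
      intro j
      have hj := j.2
      have h1 := hν.1 (n - 1 - j)
      simp only [shiftedParts, mem_Ico, Fin.val_castSucc, Fin.val_succ]
      rw [show n + 1 - 1 - (j : ℕ) = n - 1 - j + 1 by omega,
        show n + 1 - 1 - ((j : ℕ) + 1) = n - 1 - j by omega]
      omega
    · intro ν hν ν' hν' h
      simp only [mem_filter, mem_strips] at hν hν'
      refine eq_of_rowLen_eq fun i => ?_
      by_cases hi : i < n
      · have := congrFun h ⟨n - 1 - i, by omega⟩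
        simp only [shiftedParts] at this
        rw [show n - 1 - (n - 1 - i) = i by omega] at this
        omega
      · have h1 := ν.rowLen_anti n i (not_lt.1 hi)
        have h2 := ν'.rowLen_anti n i (not_lt.1 hi)
        omega
    · intro b hb
      obtain ⟨ν, h1, h2, h3⟩ := exists_shiftedParts_eq hμ (Fintype.mem_piFinset.1 hb)
      exact ⟨ν, mem_filter.2 ⟨mem_strips.2 h1, h2⟩, h3⟩
    · intro ν hν
      simp only [mem_filter, mem_strips] at hν
      rw [← ih _ hν.2, ← card_sub_card_eq hμ hν.2 hν.1, pow_add, Finset.prod_pow_eq_pow_sum]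
      ring

/-! ### Counting standard tableaux -/

/-- The number of tableaux of shape `μ` using each of the letters `0, …, N - 1` exactly once. -/
noncomputable def standardCount (μ : YoungDiagram) (N : ℕ) : ℕ :=
  ((ssyt μ N).filter fun T => ∀ i < N, wt T i = 1).card

/-- There are as many cells as letters, so injectivity of the filling forces every letter to occur.
Weak rows with distinct entries are strict. -/
theorem isStandard_iff {μ : YoungDiagram} {T : SemistandardYoungTableau μ}
    (hT : T ∈ ssyt μ μ.card) : IsStandard T ↔ ∀ i < μ.card, wt T i = 1 := by
  constructor
  · intro h i hi
    have hmaps : Set.MapsTo (fun c : ℕ × ℕ => T c.1 c.2) μ.cells (range μ.card) :=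
      fun c hc => mem_coe.2 (mem_range.2 (mem_ssyt.1 hT _ _ hc))
    have hinj : Set.InjOn (fun c : ℕ × ℕ => T c.1 c.2) μ.cells := by
      intro c hc c' hc' he
      exact Prod.ext_iff.2 (h.1 _ _ _ _ hc hc' he)
    obtain ⟨c, hc, hci⟩ := Finset.surjOn_of_injOn_of_card_le _ hmaps hinj
      (by simp [YoungDiagram.card]) (mem_coe.2 (mem_range.2 hi))
    rw [wt, Finset.card_eq_one]
    refine ⟨c, Finset.eq_singleton_iff_unique_mem.2 ⟨mem_filter.2 ⟨hc, hci⟩, fun c' hc' => ?_⟩⟩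
    exact hinj (mem_filter.1 hc').1 hc ((mem_filter.1 hc').2.trans hci.symm)
  · intro h
    have hinj : ∀ i j i' j', (i, j) ∈ μ → (i', j') ∈ μ → T i j = T i' j' → i = i' ∧ j = j' := by
      intro i j i' j' hc hc' he
      have h1 := Finset.card_le_one.1 (h _ (mem_ssyt.1 hT _ _ hc)).le (i, j)
        (mem_filter.2 ⟨hc, rfl⟩) (i', j') (mem_filter.2 ⟨hc', he.symm⟩)
      simpa using h1
    refine ⟨hinj, fun i j j' hj hc => lt_of_le_of_ne (T.row_weak hj hc) fun he => ?_⟩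
    exact hj.ne (hinj _ _ _ _ (μ.up_left_mem le_rfl hj.le hc) hc he).2

theorem numSYT_eq (μ : YoungDiagram) : numSYT μ = standardCount μ μ.card := by
  classical
  rw [numSYT, standardCount]
  congr 1
  ext T
  rw [mem_filter, mem_filter]
  exact and_congr_right isStandard_iff

theorem standardCount_succ (μ : YoungDiagram) (N : ℕ) :
    standardCount μ (N + 1) =
      ∑ ν ∈ strips μ with μ.card - ν.card = 1, standardCount ν N := by
  rw [standardCount, Finset.card_filter,
    sum_ssyt_succ μ N (fun w => if ∀ i < N + 1, w i = 1 then 1 else 0), Finset.sum_filter]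
  refine Finset.sum_congr rfl fun ν _ => ?_
  have h : ∀ S : SemistandardYoungTableau ν,
      (∀ i < N + 1, (if i = N then μ.card - ν.card else wt S i) = 1) ↔
        μ.card - ν.card = 1 ∧ ∀ i < N, wt S i = 1 := by
    intro S
    constructor
    · intro h
      refine ⟨by simpa using h N (Nat.lt_succ_self N), fun i hi => ?_⟩
      simpa [hi.ne] using h i (hi.trans (Nat.lt_succ_self N))
    · rintro ⟨h1, h2⟩ i hi
      split_ifs with h3
      · exact h1
      · exact h2 i (by omega)
  simp only [h]
  split_ifs with h1
  · rw [standardCount, Finset.card_filter]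
    simp only [h1, true_and]
  · simp [h1]

theorem standardCount_bot : standardCount ⊥ 0 = 1 := by
  simp [standardCount, ssyt_bot]

/-! ### Adding a cell: the Pieri rule for alternants -/

/-- `μ` is obtained from `ν` by adding one cell, in row `i`. -/
def AddsCell (ν μ : YoungDiagram) (i : ℕ) : Prop :=
  ∀ r, μ.rowLen r = ν.rowLen r + if r = i then 1 else 0

theorem exists_addsCell {n i : ℕ} {ν : YoungDiagram} (hi : i < n) (hν : ν.rowLen n = 0)
    (h : ∀ r, r + 1 = i → ν.rowLen i < ν.rowLen r) : ∃ μ, AddsCell ν μ i := by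
  refine ⟨ofRowFun (fun r => ν.rowLen r + if r = i then 1 else 0) ?_ n,
    rowLen_ofRowFun _ _ _ ?_⟩
  · refine antitone_nat_of_succ_le fun r => ?_
    have h1 := ν.rowLen_anti r (r + 1) (Nat.le_succ r)
    have h2 := h r
    split_ifs with h3 h4 h4
    · omega
    · subst h3
      have := h2 rfl
      omega
    · omega
    · omega
  · simp [hν, hi.ne']

theorem AddsCell.rowLen_eq_zero {n i : ℕ} {ν μ : YoungDiagram} (h : AddsCell ν μ i) (hi : i < n)
    (hν : ν.rowLen n = 0) : μ.rowLen n = 0 := by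
  rw [h n, hν, if_neg hi.ne']

theorem AddsCell.card {n i : ℕ} {ν μ : YoungDiagram} (h : AddsCell ν μ i) (hi : i < n)
    (hν : ν.rowLen n = 0) : μ.card = ν.card + 1 := by
  rw [card_eq_sum_rowLen (h.rowLen_eq_zero hi hν), card_eq_sum_rowLen hν,
    Finset.sum_congr rfl fun r _ => h r, Finset.sum_add_distrib]
  simp [hi]

theorem AddsCell.interlace {i : ℕ} {ν μ : YoungDiagram} (h : AddsCell ν μ i) :
    Interlace ν μ := by
  intro r
  have h1 := h r
  have h2 := h (r + 1)
  have h3 := ν.rowLen_anti r (r + 1) (Nat.le_succ r)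
  have h4 := μ.rowLen_anti r (r + 1) (Nat.le_succ r)
  split_ifs at h1 h2 <;> omega

theorem Interlace.exists_addsCell {n : ℕ} {ν μ : YoungDiagram} (h : Interlace ν μ)
    (hμ : μ.rowLen n = 0) (hcard : μ.card = ν.card + 1) : ∃ i < n, AddsCell ν μ i := by
  have hν : ν.rowLen n = 0 := Nat.le_zero.1 ((h n).1.trans hμ.le)
  rw [card_eq_sum_rowLen hμ, card_eq_sum_rowLen hν] at hcard
  obtain ⟨i, hi, hlt⟩ : ∃ i ∈ range n, ν.rowLen i < μ.rowLen i := by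
    refine Finset.exists_lt_of_sum_lt ?_
    omega
  refine ⟨i, mem_range.1 hi, fun r => ?_⟩
  rw [← Finset.add_sum_erase _ _ hi, ← Finset.add_sum_erase _ ν.rowLen hi] at hcard
  have hle : ∑ r ∈ (range n).erase i, ν.rowLen r ≤ ∑ r ∈ (range n).erase i, μ.rowLen r :=
    Finset.sum_le_sum fun r _ => (h r).1
  split_ifs with hr
  · subst hr
    omega
  · by_cases hrn : r < n
    · refine ((Finset.sum_eq_sum_iff_of_le fun r _ => (h r).1).1 ?_ r
        (mem_erase.2 ⟨hr, mem_range.2 hrn⟩)).symm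
      omega
    · have h1 := μ.rowLen_anti n r (not_lt.1 hrn)
      have h2 := (h r).1
      omega

theorem AddsCell.shiftedParts {n : ℕ} {ν μ : YoungDiagram} {j : Fin n}
    (h : AddsCell ν μ (n - 1 - j)) :
    shiftedParts n μ = fun l => shiftedParts n ν l + if l = j then 1 else 0 := by
  funext l
  have hl := l.2
  have hj := j.2
  have : n - 1 - (l : ℕ) = n - 1 - j ↔ l = j := by rw [Fin.ext_iff]; omega
  simp only [ChernPlethysm.shiftedParts, h _, this]
  omega

/-- Pieri rule for multiplying an alternant by the sum of the variables. -/
theorem sum_mul_alternant_shiftedParts {n : ℕ} (x : Fin n → A) {ν : YoungDiagram}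
    (hν : ν.rowLen n = 0) [DecidablePred (Interlace ν)] :
    (∑ i, x i) * alternant x (shiftedParts n ν) =
      ∑ μ ∈ partitionsOf (ν.card + 1) with μ.rowLen n = 0 ∧ Interlace ν μ,
        alternant x (shiftedParts n μ) := by
  classical
  rw [sum_mul_alternant,
    ← Finset.sum_filter_of_ne (p := fun j : Fin n => ∃ μ, AddsCell ν μ (n - 1 - j))]
  · refine Finset.sum_bij (fun j hj => (mem_filter.1 hj).2.choose) ?_ ?_ ?_ ?_
    · intro j hj
      have h := (mem_filter.1 hj).2.choose_spec
      have hjn : n - 1 - (j : ℕ) < n := by have := j.2; omega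
      exact mem_filter.2 ⟨mem_partitionsOf.2 (h.card hjn hν), h.rowLen_eq_zero hjn hν,
        h.interlace⟩
    · intro j hj l hl he
      have h1 := (mem_filter.1 hj).2.choose_spec (n - 1 - j)
      have h2 := (mem_filter.1 hl).2.choose_spec (n - 1 - j)
      rw [he, h2] at h1
      have := j.2
      have := l.2
      rw [Fin.ext_iff]
      split_ifs at h1 <;> omega
    · intro μ hμ
      obtain ⟨h1, h2, h3⟩ := mem_filter.1 hμ
      obtain ⟨i, hi, h⟩ := h3.exists_addsCell h2 (mem_partitionsOf.1 h1)
      have hj : n - 1 - (n - 1 - i) = i := by omega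
      have hex : ∃ μ, AddsCell ν μ (n - 1 - (⟨n - 1 - i, by omega⟩ : Fin n)) :=
        ⟨μ, by simpa only [hj] using h⟩
      refine ⟨⟨n - 1 - i, by omega⟩, mem_filter.2 ⟨mem_univ _, hex⟩, ?_⟩
      refine eq_of_rowLen_eq fun r => ?_
      rw [hex.choose_spec r, h r]
      simp only [hj]
    · intro j hj
      rw [AddsCell.shiftedParts (mem_filter.1 hj).2.choose_spec]
  · intro j _ hne
    by_contra hex
    have hj := j.2
    have hlt : ∃ r, r + 1 = n - 1 - (j : ℕ) ∧ ν.rowLen r ≤ ν.rowLen (n - 1 - j) := by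
      by_contra hall
      push Not at hall
      exact hex (exists_addsCell (by omega) hν hall)
    obtain ⟨r, hr, hle⟩ := hlt
    have hle' := ν.rowLen_anti r (n - 1 - j) (by omega)
    -- No cell fits because the row above has the same length. The shifted exponents in columns `j`
    -- and `j + 1` then differ by one, so raising column `j` makes them equal.
    refine hne (alternant_eq_zero_of_eq x _ (i := j) (j := ⟨j + 1, by omega⟩)
      (by simp [Fin.ext_iff]) ?_)
    simp only [shiftedParts, if_true, Fin.ext_iff]
    rw [show n - 1 - ((j : ℕ) + 1) = r by omega]
    simp
    omega

/-- Each factor `∑ i, x i` adds one cell, so the coefficients satisfy the recursion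
`standardCount_succ`, which removes the cell of the largest letter. -/
theorem sum_pow_mul_vandermonde {n : ℕ} (x : Fin n → A) (N : ℕ) :
    (∑ i, x i) ^ N * (vandermonde x).det =
      ∑ μ ∈ partitionsOf N with μ.rowLen n = 0,
        standardCount μ N • alternant x (shiftedParts n μ) := by
  classical
  induction N with
  | zero =>
    rw [Finset.sum_eq_single_of_mem (⊥ : YoungDiagram)]
    · have h : shiftedParts n ⊥ = fun j : Fin n => (j : ℕ) := by
        funext j
        simp [shiftedParts, rowLen_bot]
      rw [standardCount_bot, h, alternant_val]
      simp
    · rw [mem_filter, mem_partitionsOf]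
      exact ⟨rfl, rowLen_bot n⟩
    · intro μ hμ hne
      refine absurd (YoungDiagram.ext ?_) hne
      have := mem_partitionsOf.1 (mem_filter.1 hμ).1
      rw [YoungDiagram.cells_bot]
      exact Finset.card_eq_zero.1 this
  | succ N ih =>
    rw [pow_succ', mul_assoc, ih, Finset.mul_sum]
    have h1 : ∀ ν ∈ (partitionsOf N).filter (fun ν => ν.rowLen n = 0),
        (∑ i, x i) * standardCount ν N • alternant x (shiftedParts n ν) =
          ∑ μ ∈ partitionsOf (N + 1) with μ.rowLen n = 0 ∧ Interlace ν μ,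
            standardCount ν N • alternant x (shiftedParts n μ) := by
      intro ν hν
      obtain ⟨h2, h3⟩ := mem_filter.1 hν
      rw [mul_smul_comm, sum_mul_alternant_shiftedParts x h3, mem_partitionsOf.1 h2,
        Finset.smul_sum]
    rw [Finset.sum_congr rfl h1]
    simp only [standardCount_succ, Finset.sum_smul]
    refine Finset.sum_comm' fun ν μ => ?_
    simp only [mem_filter, mem_partitionsOf, mem_strips]
    constructor
    · rintro ⟨⟨h2, h3⟩, h4, h5, h6⟩
      exact ⟨⟨h6, by omega⟩, h4, h5⟩
    · rintro ⟨⟨h2, h3⟩, h4, h5⟩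
      have := (h2 n).1
      exact ⟨⟨by omega, by omega⟩, h4, h5, h2⟩

/-! ### The one-row Schur polynomial at the differences -/

theorem rowLen_eq_of_mem_iff {μ : YoungDiagram} {i a : ℕ} (h : ∀ j, (i, j) ∈ μ ↔ j < a) :
    μ.rowLen i = a := by
  have h1 := h (μ.rowLen i)
  have h2 := h a
  rw [YoungDiagram.mem_iff_lt_rowLen] at h1 h2
  omega

theorem rowLen_rowShape (k i : ℕ) : (rowShape k).rowLen i = if i = 0 then k else 0 := by
  refine rowLen_eq_of_mem_iff fun j => ?_
  rw [← YoungDiagram.mem_cells, rowShape]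
  split_ifs with h
  · simp [h]
  · simp [Ne.symm h]

theorem rowLen_colShape (m i : ℕ) : (colShape m).rowLen i = if i < m then 1 else 0 := by
  refine rowLen_eq_of_mem_iff fun j => ?_
  rw [← YoungDiagram.mem_cells, colShape]
  split_ifs with h <;> simp [h, eq_comm]

/-- The sign of the substitution `x ↦ c - x` in a Vandermonde determinant. -/
theorem vandermonde_det_const_sub {n : ℕ} (x : Fin n → A) (c : A) :
    (vandermonde fun i => c - x i).det = (∏ j : Fin n, (-1 : A) ^ (j : ℕ)) *
      (vandermonde x).det := by
  rw [← Matrix.det_vandermonde_sub x c, ← Matrix.det_mul_row]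
  congr 1
  ext i j
  simp only [vandermonde_apply, Matrix.of_apply]
  rw [← mul_pow]
  ring

/-- The alternant of a one-row shape, expanded along its largest exponent. -/
theorem alternant_rowShape {m : ℕ} (y : Fin (m + 1) → A) (k : ℕ) :
    alternant y (shiftedParts (m + 1) (rowShape k)) =
      ∑ i : Fin (m + 1), (-1) ^ ((i : ℕ) + m) * y i ^ (k + m) *
        (vandermonde fun j => y (i.succAbove j)).det := by
  rw [alternant, Matrix.det_succ_column _ (Fin.last m)]
  refine Finset.sum_congr rfl fun i _ => ?_
  congr 2
  · simp [shiftedParts, rowLen_rowShape]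
  · ext a b
    have hb := b.2
    simp only [shiftedParts, rowLen_rowShape, Matrix.submatrix_apply, Matrix.of_apply,
      vandermonde_apply, Fin.succAbove_last, Fin.val_castSucc]
    rw [if_neg (by omega), zero_add]

/-- The complete homogeneous polynomial of the differences `e₁ - x_i`, times the Vandermonde
determinant, in terms of Vandermonde determinants omitting one variable. -/
theorem vandermonde_mul_schurEval_rowShape {m : ℕ} (x : Fin (m + 1) → A) (k : ℕ) :
    (vandermonde x).det * schurEval (fun i => (∑ j, x j) - x i) (rowShape k) =
      ∑ i : Fin (m + 1), (-1) ^ (i : ℕ) * ((∑ j, x (i.succAbove j)) ^ (k + m) *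
        (vandermonde fun j => x (i.succAbove j)).det) := by
  set s : A := ∏ j : Fin m, (-1 : A) ^ (j : ℕ) with hs
  have hss : s * s = 1 := by
    rw [hs, ← Finset.prod_mul_distrib]
    refine Finset.prod_eq_one fun j _ => ?_
    rw [← mul_pow]
    simp
  have hm : ((-1 : A) ^ m) * (-1) ^ m = 1 := by rw [← mul_pow]; simp
  have h := vandermonde_mul_schurEval (fun i => (∑ j, x j) - x i)
    (μ := rowShape k) (n := m + 1) (by simp [rowLen_rowShape])
  rw [alternant_rowShape, vandermonde_det_const_sub, Fin.prod_univ_castSucc] at h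
  simp only [Fin.val_castSucc, Fin.val_last, ← hs, vandermonde_det_const_sub] at h
  have hy : ∀ i : Fin (m + 1), (∑ j, x j) - x i = ∑ j, x (i.succAbove j) := fun i => by
    rw [Fin.sum_univ_succAbove x i]
    ring
  -- The substitution has sign `s * (-1) ^ m` on `m + 1` variables and `s` on `m` variables.
  -- Inserting the square of the former makes `h` applicable.
  calc _ = (s * s) * ((-1) ^ m * (-1) ^ m) * ((vandermonde x).det *
        schurEval (fun i => (∑ j, x j) - x i) (rowShape k)) := by rw [hss, hm]; ring
    _ = s * (-1) ^ m * (s * (-1) ^ m * (vandermonde x).det *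
        schurEval (fun i => (∑ j, x j) - x i) (rowShape k)) := by ring
    _ = _ := by
      rw [h, Finset.mul_sum]
      refine Finset.sum_congr rfl fun i _ => ?_
      rw [hy, pow_add (-1 : A)]
      linear_combination ((-1) ^ (i : ℕ) * ((∑ j, x (i.succAbove j)) ^ (k + m) *
        (vandermonde fun j => x (i.succAbove j)).det)) * (s * s * hm + hss)

/-- Laplace expansion along the first column, which consists of ones because its exponent is `0`. -/
theorem sum_alternant_succAbove {m : ℕ} (x : Fin (m + 1) → A) (β : Fin m → ℕ) :
    ∑ i : Fin (m + 1), (-1) ^ (i : ℕ) * alternant (fun j => x (i.succAbove j)) β =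
      alternant x (Fin.cons 0 β) := by
  rw [alternant, Matrix.det_succ_column_zero]
  refine Finset.sum_congr rfl fun i _ => ?_
  simp only [Matrix.of_apply, Fin.cons_zero, pow_zero, mul_one]
  rfl

theorem rowLen_add_colShape (μ : YoungDiagram) (m i : ℕ) :
    (add μ (colShape m)).rowLen i = μ.rowLen i + if i < m then 1 else 0 := by
  rw [rowLen_add, rowLen_colShape]

theorem card_add_colShape {μ : YoungDiagram} {m : ℕ} (hμ : μ.rowLen m = 0) :
    (add μ (colShape m)).card = μ.card + m := by
  rw [card_eq_sum_rowLen hμ, card_eq_sum_rowLen (m := m) (by simp [rowLen_add_colShape, hμ])]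
  rw [Finset.sum_congr rfl fun i hi => by
    rw [rowLen_add_colShape, if_pos (mem_range.1 hi)], Finset.sum_add_distrib]
  simp

/-- The added column raises the `m` shifted parts by one, which is the difference between the shifts
for `m` and `m + 1` variables. This is where `(1^m)` enters the theorem. -/
theorem cons_shiftedParts_add_colShape {μ : YoungDiagram} {m : ℕ} (hμ : μ.rowLen m = 0) :
    (Fin.cons 0 (shiftedParts m (add μ (colShape m))) : Fin (m + 1) → ℕ) =
      shiftedParts (m + 1) μ := by
  funext j
  refine Fin.cases ?_ (fun j => ?_) j
  · simp [shiftedParts, hμ]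
  · have hj := j.2
    simp only [Fin.cons_succ, shiftedParts, rowLen_add_colShape, Fin.val_succ]
    rw [if_pos (by omega), show m + 1 - 1 - ((j : ℕ) + 1) = m - 1 - j by omega]
    omega

theorem exists_add_colShape_eq {ξ : YoungDiagram} {m : ℕ} (hξ : ξ.rowLen m = 0)
    (h : ∀ i < m, 0 < ξ.rowLen i) : ∃ μ, μ.rowLen m = 0 ∧ add μ (colShape m) = ξ := by
  have hanti : Antitone fun i => ξ.rowLen i - 1 := fun i j hij =>
    Nat.sub_le_sub_right (ξ.rowLen_anti i j hij) 1
  have hrow := rowLen_ofRowFun _ hanti m (by simp [hξ])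
  refine ⟨ofRowFun _ hanti m, by simp [hrow, hξ], eq_of_rowLen_eq fun i => ?_⟩
  rw [rowLen_add_colShape, hrow]
  split_ifs with hi
  · have := h i hi
    omega
  · have := ξ.rowLen_anti m i (not_lt.1 hi)
    omega

theorem vandermonde_mul_schurEval_rowShape_eq_sum {m : ℕ} (x : Fin (m + 1) → A) (k : ℕ) :
    (vandermonde x).det * schurEval (fun i => (∑ j, x j) - x i) (rowShape k) =
      ∑ μ ∈ (partitionsOf k).filter (fun μ => μ.colLen 0 < m + 1),
        numSYT (add μ (colShape m)) • alternant x (shiftedParts (m + 1) μ) := by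
  rw [vandermonde_mul_schurEval_rowShape]
  simp only [sum_pow_mul_vandermonde, Finset.mul_sum]
  rw [Finset.sum_comm]
  simp only [mul_smul_comm, ← Finset.smul_sum, sum_alternant_succAbove]
  symm
  have hrow : ∀ {μ : YoungDiagram}, μ ∈ (partitionsOf k).filter (fun μ => μ.colLen 0 < m + 1) →
      μ.card = k ∧ μ.rowLen m = 0 := by
    intro μ hμ
    rw [mem_filter, mem_partitionsOf, Nat.lt_succ_iff, colLen_zero_le_iff] at hμ
    exact hμ
  refine Finset.sum_of_injOn (fun μ => add μ (colShape m)) ?_ ?_ ?_ ?_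
  · intro μ _ ν _ h
    refine eq_of_rowLen_eq fun i => ?_
    have := congrArg (fun ξ : YoungDiagram => ξ.rowLen i) h
    simpa only [rowLen_add_colShape, Nat.add_right_cancel_iff] using this
  · intro μ hμ
    obtain ⟨h1, h2⟩ := hrow hμ
    refine mem_coe.2 (mem_filter.2 ⟨mem_partitionsOf.2 ?_, ?_⟩)
    · rw [card_add_colShape h2, h1]
    · simp [rowLen_add_colShape, h2]
  · intro ξ hξ hnot
    rw [mem_filter, mem_partitionsOf] at hξ
    obtain ⟨i, hi, hi0⟩ : ∃ i < m, ξ.rowLen i = 0 := by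
      by_contra hall
      push Not at hall
      obtain ⟨μ, h1, rfl⟩ := exists_add_colShape_eq hξ.2
        fun i hi => Nat.pos_of_ne_zero (hall i hi)
      refine hnot ⟨μ, mem_coe.2 (mem_filter.2 ⟨mem_partitionsOf.2 ?_, ?_⟩), rfl⟩
      · have := card_add_colShape h1
        omega
      · rw [Nat.lt_succ_iff, colLen_zero_le_iff]
        exact h1
    have h0 := ξ.rowLen_anti i (m - 1) (by omega)
    -- Here `ξ` has fewer than `m` rows, so its smallest shifted part is `0` and repeats the
    -- prepended exponent.
    rw [alternant_eq_zero_of_eq x _ (i := 0) (j := Fin.succ ⟨0, by omega⟩)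
      (Fin.succ_ne_zero _).symm, smul_zero]
    simp only [Fin.cons_zero, Fin.cons_succ, shiftedParts, Nat.sub_zero]
    omega
  · intro μ hμ
    obtain ⟨h1, h2⟩ := hrow hμ
    rw [cons_shiftedParts_add_colShape h2, numSYT_eq, card_add_colShape h2, h1]

/-! ### Cancelling the Vandermonde determinant and base change -/

theorem map_schurEval {B : Type*} [CommRing B] (f : A →+* B) {n : ℕ} (x : Fin n → A)
    (μ : YoungDiagram) : f (schurEval x μ) = schurEval (fun i => f (x i)) μ := by
  simp [schurEval]

theorem schurBar_eq {R : Type*} [CommRing R] (n : ℕ) (μ : YoungDiagram) :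
    schurBar R n μ = schurEval (fun i : Fin n =>
      (∑ j, (MvPolynomial.X j : MvPolynomial (Fin n) R)) - MvPolynomial.X i) μ := by
  simp [schurBar, schur, schurEval]

/-- Over `ℤ` the polynomial ring is a domain and the variables are distinct, so the Vandermonde
determinant can be cancelled. The case of general `R` follows along `ℤ → R`. -/
theorem schurEval_rowShape_int (m k : ℕ) :
    schurEval (fun i : Fin (m + 1) => (∑ j, (MvPolynomial.X j : MvPolynomial (Fin (m + 1)) ℤ)) -
        MvPolynomial.X i) (rowShape k) =
      ∑ μ ∈ (partitionsOf k).filter (fun μ => μ.colLen 0 < m + 1),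
        numSYT (add μ (colShape m)) •
          schurEval (MvPolynomial.X : Fin (m + 1) → MvPolynomial (Fin (m + 1)) ℤ) μ := by
  have hV : (vandermonde (MvPolynomial.X : Fin (m + 1) → MvPolynomial (Fin (m + 1)) ℤ)).det ≠ 0 :=
    Matrix.det_vandermonde_ne_zero_iff.2 (MvPolynomial.X_injective)
  refine mul_left_cancel₀ hV ?_
  rw [vandermonde_mul_schurEval_rowShape_eq_sum, Finset.mul_sum]
  refine Finset.sum_congr rfl fun μ hμ => ?_
  rw [mem_filter, Nat.lt_succ_iff, colLen_zero_le_iff] at hμ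
  rw [mul_smul_comm, vandermonde_mul_schurEval]
  exact Nat.le_zero.1 ((μ.rowLen_anti m (m + 1) (Nat.le_succ m)).trans hμ.2.le)

end ChernPlethysm

theorem theorem3p4 {R : Type*} [CommRing R] (n k : ℕ) (hn : 1 ≤ n) :
    ChernPlethysm.schurBar R n (ChernPlethysm.rowShape k) =
      ∑ μ ∈ (ChernPlethysm.partitionsOf k).filter (fun μ => μ.colLen 0 < n),
        ChernPlethysm.numSYT (ChernPlethysm.add μ (ChernPlethysm.colShape (n - 1))) •
          ChernPlethysm.schur R n μ := by
  obtain ⟨m, rfl⟩ : ∃ m, n = m + 1 := ⟨n - 1, by omega⟩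
  have h := congrArg (MvPolynomial.map (Int.castRingHom R))
    (ChernPlethysm.schurEval_rowShape_int m k)
  simp only [map_sum, map_nsmul, ChernPlethysm.map_schurEval, map_sub, MvPolynomial.map_X] at h
  rw [ChernPlethysm.schurBar_eq]
  exact h
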